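/- Call a commutative ring $R$ an absolute complete intersection if it is isomorphic to $Q/(f_1,\dots,f_c)$ for some regular local ring $Q$ and some (possibly empty) regular sequence $f_1,\dots,f_c$ in $Q$. Theorem. Let $R$ be a commutative Noetherian local ring with maximal ideal $\mathfrak{n}$, let $\widehat R$ be its $\mathfrak{n}$-adic completion, and regard $R$ as a subring of $\widehat R$. Let $(T,\mathfrak{m})$ be a complete regular local ring whose Krull dimension equals the embedding dimension $\dim_{R/\mathfrak{n}}(\mathfrak{n}/\mathfrak{n}^2)$ of $R$, and let $\pi\colon T\to\widehat R$ be a surjective ring homomorphism whose kernel is generated by a regular sequence contained in $\mathfrak{m}^2$. Consider the following condition. (L) There is a subring $S$ of $T$ such that $S$ is a regular local ring, the inclusion $S\to T$ is a local homomorphism which induces an isomorphism $\widehat S\cong T$ from the completion of $S$ at its maximal ideal, $S$ contains a generating set of the ideal $\ker\pi$ of $T$, and $\pi$ restricts to a surjective local homomorphism $S\to R$ (that is, $\pi(S)=R$ inside $\widehat R$). If (L) holds, then $R$ is an absolute complete intersection. Conversely, if $R$ contains a field of characteristic zero and $R$ is an absolute complete intersection, then (L) holds. -/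

import Mathlib

open IsLocalRing

universe u

/-- `R` is a complete intersection in the absolute sense: it is isomorphic to the quotient of a
regular local ring by an ideal generated by a regular sequence (possibly empty). -/
def IsAbsoluteCompleteIntersection (R : Type u) [CommRing R] : Prop :=
  ∃ (S : Type u) (_ : CommRing S) (_ : IsRegularLocalRing S) (rs : List S),
    RingTheory.Sequence.IsRegular S rs ∧ Nonempty (R ≃+* S ⧸ Ideal.ofList rs)

/-- The embedding dimension of a local ring, i.e. the dimension of `𝔪 / 𝔪 ^ 2` over the residue
field. -/
noncomputable def embeddingDimension (R : Type u) [CommRing R] [IsLocalRing R] : ℕ :=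
  Module.finrank (ResidueField R) (CotangentSpace R)

/-- `R` contains a field of characteristic zero. -/
def ContainsCharZeroField (R : Type u) [CommRing R] : Prop :=
  ∃ K : Subring R, IsField K ∧ CharZero K

/-- For a ring homomorphism `π : T → R̂`, the subring `S` of `T` completes the diagram formed by `π`
and the canonical map `R → R̂` to a commutative square of local homomorphisms
```
S ⊆ T
↓   ↓
R → R̂
```
in which `S` is a regular local ring containing a generating set of `ker π`, the inclusion `S ⊆ T`
induces an isomorphism from the completion of `S` onto `T`, and `π` restricts to a surjection
`S → R`. -/
def CompletesDiagram {R T : Type u} [CommRing R] [IsLocalRing R] [CommRing T] [IsLocalRing T]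
    (π : T →+* AdicCompletion (maximalIdeal R) R) (S : Subring T) : Prop :=
  ∃ _ : IsRegularLocalRing S,
    IsLocalHom S.subtype ∧
    -- the completion of `S` is naturally isomorphic to `T`, i.e. isomorphic to `T` over `S`
    Nonempty (AdicCompletion (maximalIdeal S) S ≃ₐ[S] T) ∧
    -- `S` contains a generating set of `ker π`
    (∃ G : Set T, G ⊆ S ∧ Ideal.span G = RingHom.ker π) ∧
    -- `π` restricts to a surjective local homomorphism `ρ : S → R`
    ∃ ρ : S →+* R, IsLocalHom ρ ∧ Function.Surjective ρ ∧
      ∀ s : S, algebraMap R (AdicCompletion (maximalIdeal R) R) (ρ s) = π s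

/-!
Suppose first that `S` completes the diagram, and let `I` be the kernel of `S → R`. The ideal
`I T = ker π` is generated by a regular sequence. In a Noetherian local ring, every irredundant list
of generators of such an ideal is a regular sequence, by an exchange argument
(`RingTheory.Sequence.IsWeaklyRegular.of_ofList_eq`). Hence generators of `ker π` that come from `I`
can be chosen to form a regular sequence in `T`; as `T` is faithfully flat over `S`, they form a
regular sequence in `S` and generate `I` (`Ideal.exists_isRegular_of_map_eq_ofList`).

Conversely, let `R` be a quotient of a regular local ring. Dividing out elements of the kernel that
belong to a regular system of parameters, one gets a surjection `f : Q → R` from a regular local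
ring `Q` with `ker f ⊆ 𝔪 ^ 2` (`IsRegularLocalRing.exists_surjective_ker_le`), so that
`dim Q = edim R = dim T`. In characteristic zero there is an isomorphism `Q̂ ≅ T` compatible with the
maps to `R̂` (`AdicCompletion.exists_ringEquiv_of_surjective`). To construct it, let `κ` be the
residue field of `Q̂`. As `κ` is formally smooth over `ℚ`, it embeds into `Q̂` as a coefficient
field, and the resulting map `κ → R̂` lifts to `T`, which is complete with respect to `ker π`.
Mapping the variables to corresponding generators of the maximal ideals gives maps from a power
series ring over `κ` to `Q̂` and `T`, compatible over `R̂`. They are surjective by completeness and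
injective for reasons of dimension. The image of `Q` in `T` is the required subring; it contains
generators of `ker π` because the kernel of `Q̂ → R̂` is the extension of `ker f`
(`AdicCompletion.ker_mapRingHom_of_surjective`).
-/

/-! ### Generators of ideals generated by regular sequences -/

namespace Ideal

/-- The algebraic input of the exchange argument: an element `x` of `I + (l)` that is not in
`I + 𝔪 (l)` involves some member `r` of `l` with a unit coefficient. -/
lemma exists_unit_sub_mul_mem_sup_ofList {A : Type*} [CommRing A] [IsLocalRing A] (l : List A)
    (I : Ideal A) {x : A} (hx : x ∈ I ⊔ ofList l) (hx' : x ∉ I ⊔ maximalIdeal A * ofList l) :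
    ∃ l₁ r l₂ u, l = l₁ ++ r :: l₂ ∧ IsUnit u ∧ x - u * r ∈ I ⊔ ofList (l₁ ++ l₂) := by
  induction l generalizing I with
  | nil => simp_all
  | cons r l ih =>
    rw [ofList_cons] at hx hx'
    obtain ⟨a, ha, y, hy, rfl⟩ := Submodule.mem_sup.1 hx
    obtain ⟨b, hb, z, hz, rfl⟩ := Submodule.mem_sup.1 hy
    obtain ⟨c, rfl⟩ := mem_span_singleton'.1 hb
    by_cases hc : IsUnit c
    · refine ⟨[], r, l, c, rfl, hc, ?_⟩
      rw [show a + (c * r + z) - c * r = a + z by ring]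
      exact Submodule.add_mem_sup ha hz
    · have hcr : c * r ∈ maximalIdeal A * span {r} :=
        mul_mem_mul ((mem_maximalIdeal _).2 hc) (mem_span_singleton_self r)
      obtain ⟨l₁, r', l₂, u, rfl, hu, h⟩ := ih (I ⊔ maximalIdeal A * span {r})
        (by
          rw [← add_assoc]
          exact Submodule.add_mem_sup (Submodule.add_mem_sup ha hcr) hz)
        (by rwa [sup_assoc, ← mul_sup])
      refine ⟨r :: l₁, r', l₂, u, rfl, hu, ?_⟩
      rw [List.cons_append, ofList_cons, ← sup_assoc]
      have hle : I ⊔ maximalIdeal A * span {r} ≤ I ⊔ span {r} := sup_le_sup_left mul_le_right _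
      exact sup_le_sup_right hle _ h

lemma ofList_perm {A : Type*} [CommRing A] {l l' : List A} (h : l.Perm l') :
    ofList l = ofList l' := by
  simp only [ofList, h.mem_iff]

end Ideal

namespace RingTheory.Sequence

open Ideal

lemma isSMulRegular_quotient_smul_top_iff {A : Type*} [CommRing A] (J : Ideal A) (r : A) :
    IsSMulRegular (A ⧸ (J • ⊤ : Submodule A A)) r ↔ ∀ x, r * x ∈ J → x ∈ J := by
  rw [isSMulRegular_quotient_iff_mem_of_smul_mem]
  simp

/-- A weakly regular sequence remains so after replacing an element `r` by `g`, if `g` is a unit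
multiple of `r` modulo the other elements. -/
lemma IsWeaklyRegular.exchange {A : Type*} [CommRing A] [IsLocalRing A] [IsNoetherianRing A]
    {l₁ l₂ : List A} {r g u : A} (h : IsWeaklyRegular A (l₁ ++ r :: l₂))
    (hm : ∀ x ∈ l₁ ++ r :: l₂, x ∈ maximalIdeal A) (hu : IsUnit u)
    (hg : g - u * r ∈ ofList (l₁ ++ l₂)) : IsWeaklyRegular A (l₁ ++ g :: l₂) := by
  have hlm : ∀ x ∈ l₁ ++ l₂, x ∈ maximalIdeal A := fun x hx ↦ hm x (by
    simp only [List.mem_append, List.mem_cons] at hx ⊢; tauto)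
  have hperm (a : A) : (l₁ ++ a :: l₂).Perm ((l₁ ++ l₂) ++ [a]) :=
    List.perm_middle.trans (List.perm_append_singleton a (l₁ ++ l₂)).symm
  have hgm : g ∈ maximalIdeal A := by
    rw [← sub_add_cancel g (u * r)]
    exact add_mem ((span_le.2 hlm : ofList _ ≤ _) hg) (mul_mem_left _ _ (hm r (by simp)))
  -- A regular sequence in a local ring can be permuted, so `r` may be assumed to come last.
  have h' := isWeaklyRegular_of_perm_of_subset_maximalIdeal h (hperm r) hm
  refine isWeaklyRegular_of_perm_of_subset_maximalIdeal (rs := (l₁ ++ l₂) ++ [g]) ?_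
    (hperm g).symm ?_
  · rw [isWeaklyRegular_append_iff, isWeaklyRegular_singleton_iff,
      isSMulRegular_quotient_smul_top_iff] at h' ⊢
    refine ⟨h'.1, fun x hx ↦ h'.2 x ?_⟩
    rw [← (ofList (l₁ ++ l₂)).unit_mul_mem_iff_mem hu,
      show u * (r * x) = g * x - x * (g - u * r) by ring]
    exact sub_mem hx (mul_mem_left _ _ hg)
  · intro x hx
    rcases List.mem_append.1 hx with hx | hx
    · exact hlm x hx
    · rwa [List.mem_singleton.1 hx]

/-- In a Noetherian local ring, an irredundant list of generators of an ideal generated by a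
regular sequence is itself regular: its members can be exchanged into the given sequence one after
the other. -/
lemma IsWeaklyRegular.of_ofList_eq {A : Type*} [CommRing A] [IsLocalRing A] [IsNoetherianRing A]
    {rs gs : List A} (h : IsWeaklyRegular A rs) (hm : ∀ x ∈ rs, x ∈ maximalIdeal A)
    (heq : ofList gs = ofList rs)
    (hmin : ∀ l₁ g l₂, gs = l₁ ++ g :: l₂ → ofList (l₁ ++ l₂) ≠ ofList rs) :
    IsWeaklyRegular A gs := by
  suffices H : ∀ l₁ l₂, gs = l₁ ++ l₂ →
      ∃ l, IsWeaklyRegular A (l₁ ++ l) ∧ ofList (l₁ ++ l) = ofList rs by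
    obtain ⟨l, hl, -⟩ := H gs [] (by simp)
    exact ((isWeaklyRegular_append_iff _ _ _).1 hl).1
  intro l₁
  induction l₁ using List.reverseRecOn with
  | nil => exact fun _ _ ↦ ⟨rs, h, rfl⟩
  | append_singleton l₁ g ih =>
    intro l₂ hgs
    rw [List.append_assoc, List.singleton_append] at hgs
    obtain ⟨l, hl, hleq⟩ := ih (g :: l₂) hgs
    have hJm : ofList rs ≤ maximalIdeal A := span_le.2 hm
    have hgJ : g ∈ ofList l₁ ⊔ ofList l := by
      rw [← ofList_append, hleq, ← heq, hgs]
      exact subset_span (by simp)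
    have hgJ' : g ∉ ofList l₁ ⊔ maximalIdeal A * ofList l := by
      -- Otherwise `g` would be redundant by Nakayama's lemma.
      intro hg
      refine hmin l₁ g l₂ hgs (le_antisymm ?_ ?_)
      · rw [← heq, hgs, ofList_append, ofList_append, ofList_cons]
        exact sup_le_sup_left le_sup_right _
      · refine Submodule.le_of_le_smul_of_le_jacobson_bot (I := maximalIdeal A)
          (fg_of_isNoetherianRing _) (maximalIdeal_le_jacobson _) ?_
        conv_lhs => rw [← heq, hgs, ofList_append, ofList_cons]
        rw [ofList_append]
        have hle : ofList l₁ ⊔ maximalIdeal A * ofList l ≤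
            ofList l₁ ⊔ ofList l₂ ⊔ maximalIdeal A • ofList rs := by
          refine sup_le (le_sup_of_le_left le_sup_left) (le_sup_of_le_right ?_)
          refine mul_le_mul_right ?_ _
          rw [← hleq, ofList_append]
          exact le_sup_right
        refine sup_le (le_sup_of_le_left le_sup_left) (sup_le ?_ (le_sup_of_le_left le_sup_right))
        exact (span_singleton_le_iff_mem _).2 (hle hg)
    obtain ⟨k₁, r, k₂, u, rfl, hu, hsub⟩ := exists_unit_sub_mul_mem_sup_ofList l _ hgJ hgJ'
    have hmem : ∀ x ∈ l₁ ++ (k₁ ++ r :: k₂), x ∈ maximalIdeal A := fun x hx ↦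
      hJm (hleq ▸ subset_span hx)
    rw [← ofList_append, ← List.append_assoc] at hsub
    rw [← List.append_assoc] at hl hmem hleq
    have hex := hl.exchange hmem hu hsub
    have hgm : g ∈ maximalIdeal A := hJm (by rw [← heq, hgs]; exact subset_span (by simp))
    have hperm : (l₁ ++ k₁ ++ g :: k₂).Perm (l₁ ++ [g] ++ (k₁ ++ k₂)) := by
      rw [List.append_assoc, List.append_assoc]
      exact List.Perm.append_left l₁ List.perm_middle
    refine ⟨k₁ ++ k₂, isWeaklyRegular_of_perm_of_subset_maximalIdeal hex hperm ?_, ?_⟩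
    · intro x hx
      rcases List.mem_append.1 hx with hx | hx
      · exact hmem x (List.mem_append_left _ hx)
      · rcases List.mem_cons.1 hx with rfl | hx
        · exact hgm
        · exact hmem x (List.mem_append_right _ (List.mem_cons_of_mem _ hx))
    · rw [← ofList_perm hperm, ← hleq, ofList_perm (List.perm_middle (a := g)),
        ofList_perm (List.perm_middle (a := r)), ofList_cons, ofList_cons]
      have key : g - u * r ∈ ofList (l₁ ++ k₁ ++ k₂) := hsub
      apply le_antisymm
      · refine sup_le ((span_singleton_le_iff_mem _).2 ?_) le_sup_right
        rw [← sub_add_cancel g (u * r)]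
        exact add_mem (Submodule.mem_sup_right key)
          (Submodule.mem_sup_left (mul_mem_left _ _ (mem_span_singleton_self r)))
      · refine sup_le ((span_singleton_le_iff_mem _).2 ?_) le_sup_right
        rw [← unit_mul_mem_iff_mem _ hu, show u * r = g - (g - u * r) by ring]
        exact sub_mem (Submodule.mem_sup_left (mem_span_singleton_self g))
          (Submodule.mem_sup_right key)

/-- Weak regularity of a sequence descends along faithfully flat ring extensions. -/
lemma IsWeaklyRegular.of_map_faithfullyFlat {A B : Type*} [CommRing A] [CommRing B] [Algebra A B]
    [Module.FaithfullyFlat A B] {rs : List A}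
    (h : IsWeaklyRegular B (rs.map (algebraMap A B))) : IsWeaklyRegular A rs := by
  rw [isWeaklyRegular_iff] at h ⊢
  intro i hi
  have hB := h i (by simpa using hi)
  rw [isSMulRegular_quotient_smul_top_iff, List.getElem_map, ← List.map_take,
    ← map_ofList] at hB
  rw [isSMulRegular_quotient_smul_top_iff]
  intro x hx
  rw [← comap_map_eq_self_of_faithfullyFlat (B := B) (ofList (rs.take i)), mem_comap]
  apply hB
  rw [← map_mul]
  exact mem_map_of_mem _ hx

end RingTheory.Sequence

open RingTheory.Sequence Ideal in
/-- Let `A → B` be a faithfully flat local homomorphism of Noetherian local rings. An ideal of `A`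
is generated by a regular sequence if its extension to `B` is. -/
lemma Ideal.exists_isRegular_of_map_eq_ofList {A B : Type*} [CommRing A] [CommRing B]
    [IsLocalRing A] [IsNoetherianRing A] [IsLocalRing B] [IsNoetherianRing B] [Algebra A B]
    [Module.FaithfullyFlat A B] [IsLocalHom (algebraMap A B)] (I : Ideal A) {rs : List B}
    (h : IsRegular B rs) (hI : I.map (algebraMap A B) = ofList rs) :
    ∃ gs : List A, IsRegular A gs ∧ ofList gs = I := by
  have hne : ofList rs ≠ ⊤ := fun h' ↦ h.top_ne_smul (by simp [h'])
  have hm : ∀ x ∈ rs, x ∈ maximalIdeal B := fun x hx ↦ le_maximalIdeal hne (subset_span hx)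
  -- A list of elements of `I` generating its extension, of minimal length.
  have hex : ∃ n, ∃ gs : List A, gs.length = n ∧ (∀ g ∈ gs, g ∈ I) ∧
      ofList (gs.map (algebraMap A B)) = ofList rs := by
    obtain ⟨s, hs⟩ := I.fg_of_isNoetherianRing
    have hsI : ofList s.toList = I := by simpa [ofList] using hs
    exact ⟨_, s.toList, rfl, fun g hg ↦ hsI ▸ subset_span hg, by rw [← map_ofList, hsI, hI]⟩
  classical
  obtain ⟨gs, hlen, hgI, hgs⟩ := Nat.find_spec hex
  have hreg : IsWeaklyRegular B (gs.map (algebraMap A B)) := by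
    refine h.toIsWeaklyRegular.of_ofList_eq hm hgs ?_
    intro l₁ g l₂ heq hbad
    obtain ⟨k₁, k', rfl, rfl, hk'⟩ := List.map_eq_append_iff.1 heq
    obtain ⟨g', k₂, rfl, rfl, rfl⟩ := List.map_eq_cons_iff.1 hk'
    refine Nat.find_min hex (m := (k₁ ++ k₂).length) ?_ ⟨k₁ ++ k₂, rfl, fun g hg ↦ hgI g ?_, ?_⟩
    · rw [← hlen]; simp
    · simp only [List.mem_append, List.mem_cons] at hg ⊢; tauto
    · simpa using hbad
  have hgsI : ofList gs = I := by
    rw [← comap_map_eq_self_of_faithfullyFlat (B := B) I, hI, ← hgs, ← map_ofList,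
      comap_map_eq_self_of_faithfullyFlat]
  refine ⟨gs, IsRegular.of_isWeaklyRegular_of_mem_maximalIdeal A (fun r hr ↦ ?_)
    hreg.of_map_faithfullyFlat, hgsI⟩
  have hItop : I ≠ ⊤ := by
    rintro rfl
    exact hne (by rw [← hI, Ideal.map_top])
  exact le_maximalIdeal hItop (hgsI ▸ subset_span hr)

/-- Existence of `S` implies the complete intersection property: the kernel of `S → R` extends
to `ker π`, which is generated by a regular sequence, and `T` is faithfully flat over `S`. -/
lemma CompletesDiagram.isAbsoluteCompleteIntersection {R T : Type u} [CommRing R] [IsLocalRing R]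
    [IsNoetherianRing R] [CommRing T] [IsLocalRing T] [IsNoetherianRing T]
    {π : T →+* AdicCompletion (maximalIdeal R) R} {S : Subring T} (h : CompletesDiagram π S)
    (hker : ∃ rs : List T, RingTheory.Sequence.IsRegular T rs ∧
      Ideal.ofList rs = RingHom.ker π) : IsAbsoluteCompleteIntersection R := by
  obtain ⟨hS, hloc, ⟨e⟩, ⟨G, hGS, hG⟩, ρ, -, hρ, hcomm⟩ := h
  obtain ⟨rs, hrs, hrsπ⟩ := hker
  have hloc' : IsLocalHom (algebraMap S T) := hloc
  have : Module.Flat S T := Module.Flat.of_linearEquiv e.symm.toLinearEquiv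
  have : Module.FaithfullyFlat S T := .of_flat_of_isLocalHom
  have hinj : Function.Injective (algebraMap R (AdicCompletion (maximalIdeal R) R)) :=
    AdicCompletion.of_injective _ _
  have hmem (s : S) : s ∈ RingHom.ker ρ ↔ (s : T) ∈ RingHom.ker π := by
    rw [RingHom.mem_ker, RingHom.mem_ker, ← hcomm s, map_eq_zero_iff _ hinj]
  have hmap : (RingHom.ker ρ).map (algebraMap S T) = Ideal.ofList rs := by
    rw [hrsπ]
    refine le_antisymm (Ideal.map_le_iff_le_comap.2 fun s hs ↦ (hmem s).1 hs) ?_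
    rw [← hG, Ideal.span_le]
    intro g hg
    exact Ideal.mem_map_of_mem (algebraMap S T) (x := ⟨g, hGS hg⟩)
      ((hmem _).2 (hG ▸ Ideal.subset_span hg))
  obtain ⟨gs, hgs, hgsρ⟩ := Ideal.exists_isRegular_of_map_eq_ofList (RingHom.ker ρ) hrs hmap
  exact ⟨S, inferInstance, hS, gs, hgs,
    ⟨(RingHom.quotientKerEquivOfSurjective hρ).symm.trans (Ideal.quotEquivOfEq hgsρ.symm)⟩⟩

/-! ### Minimal presentations over regular local rings -/

namespace Ideal

lemma spanFinrank_ofList_le {A : Type*} [CommRing A] (l : List A) :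
    (ofList l).spanFinrank ≤ l.length := by
  classical
  have h : {r | r ∈ l} = (l.toFinset : Set A) := by ext; simp
  refine (Submodule.spanFinrank_span_le_ncard_of_finite (h ▸ l.toFinset.finite_toSet)).trans ?_
  rw [h, Set.ncard_coe_finset]
  exact l.toFinset_card_le

lemma exists_ofList_eq_length_eq_spanFinrank {A : Type*} [CommRing A] [IsNoetherianRing A]
    (I : Ideal A) : ∃ l : List A, ofList l = I ∧ l.length = I.spanFinrank := by
  have hfg := I.fg_of_isNoetherianRing
  have hfin := Submodule.FG.finite_generators hfg
  refine ⟨hfin.toFinset.toList, ?_, ?_⟩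
  · simpa [ofList] using I.span_generators
  · rw [Finset.length_toList, ← Submodule.FG.generators_ncard hfg, Set.ncard_eq_toFinset_card _ hfin]

end Ideal

namespace IsLocalRing

open Ideal

/-- A surjection of Noetherian local rings whose kernel lies in the square of the maximal ideal does
not decrease the embedding dimension. -/
lemma spanFinrank_maximalIdeal_le_of_ker_le {A B : Type*} [CommRing A] [IsLocalRing A]
    [IsNoetherianRing A] [CommRing B] [IsLocalRing B] [IsNoetherianRing B] {f : A →+* B}
    (hf : Function.Surjective f) (hker : RingHom.ker f ≤ maximalIdeal A ^ 2) :
    (maximalIdeal A).spanFinrank ≤ (maximalIdeal B).spanFinrank := by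
  obtain ⟨l, hl, hlen⟩ := exists_ofList_eq_length_eq_spanFinrank (maximalIdeal B)
  obtain ⟨k, rfl⟩ := List.map_surjective_iff.2 hf l
  have hloc := Function.Surjective.isLocalHom f hf
  suffices h : maximalIdeal A = ofList k by
    rw [h, ← hlen, List.length_map]
    exact spanFinrank_ofList_le k
  rw [← map_ofList, ← map_maximalIdeal_of_surjective f hf] at hl
  have hcomap := congrArg (comap f) hl
  rw [comap_map_of_surjective' f hf, comap_map_of_surjective' f hf] at hcomap
  have hkm : RingHom.ker f ≤ maximalIdeal A := hker.trans (pow_le_self two_ne_zero)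
  rw [sup_eq_left.2 hkm] at hcomap
  refine le_antisymm ?_ (le_sup_left.trans hcomap.le)
  refine Submodule.le_of_le_smul_of_le_jacobson_bot (I := maximalIdeal A)
    (fg_of_isNoetherianRing _) (maximalIdeal_le_jacobson _) (hcomap.ge.trans ?_)
  rw [smul_eq_mul, ← pow_two]
  exact sup_le_sup_left hker _

end IsLocalRing

namespace IsRegularLocalRing

open Ideal

/-- A regular local ring modulo a member of a regular system of parameters is regular, of smaller
embedding dimension. -/
lemma quotient_span_singleton {A : Type*} [CommRing A] [IsRegularLocalRing A] {x : A}
    (hx : x ∈ maximalIdeal A) (hx' : x ∉ maximalIdeal A ^ 2) :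
    ∃ _ : IsRegularLocalRing (A ⧸ span {x}),
      (maximalIdeal (A ⧸ span {x})).spanFinrank < (maximalIdeal A).spanFinrank := by
  obtain ⟨l, hl, hlen⟩ := exists_ofList_eq_length_eq_spanFinrank (maximalIdeal A)
  obtain ⟨l₁, r, l₂, u, rfl, hu, hsub⟩ := exists_unit_sub_mul_mem_sup_ofList l ⊥ (x := x)
    (by rwa [bot_sup_eq, hl]) (by rwa [bot_sup_eq, hl, ← pow_two])
  rw [bot_sup_eq] at hsub
  have : Nontrivial (A ⧸ span {x}) := Quotient.nontrivial_iff.2 fun h ↦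
    (maximalIdeal.isMaximal A).ne_top
      (top_le_iff.1 (h ▸ (span_singleton_le_iff_mem _).2 hx))
  have hsurj : Function.Surjective (Ideal.Quotient.mk (span {x})) := Quotient.mk_surjective
  have hlocal : IsLocalRing (A ⧸ span {x}) := .of_surjective' _ hsurj
  have hmax : maximalIdeal (A ⧸ span {x}) =
      ofList ((l₁ ++ l₂).map (Ideal.Quotient.mk (span {x}))) := by
    rw [← map_maximalIdeal_of_surjective _ hsurj, ← hl, ← map_ofList]
    refine le_antisymm ?_ (map_mono ?_)
    · rw [ofList_perm List.perm_middle, ofList_cons, Ideal.map_sup]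
      refine sup_le ?_ le_rfl
      rw [map_le_iff_le_comap, span_singleton_le_iff_mem, mem_comap, ← unit_mul_mem_iff_mem _
        (hu.map (Ideal.Quotient.mk (span {x}))), ← map_mul,
        show u * r = x - (x - u * r) by ring, map_sub,
        Ideal.Quotient.eq_zero_iff_mem.2 (mem_span_singleton_self x), zero_sub, neg_mem_iff]
      exact mem_map_of_mem _ hsub
    · rw [ofList_perm (l := l₁ ++ r :: l₂) List.perm_middle, ofList_cons]
      exact le_sup_right
  have hle : (maximalIdeal (A ⧸ span {x})).spanFinrank + 1 ≤ (maximalIdeal A).spanFinrank := by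
    rw [hmax, ← hlen]
    refine (add_le_add_left (spanFinrank_ofList_le _) 1).trans ?_
    simp [add_assoc]
  refine ⟨.of_spanFinrank_maximalIdeal_le _ ?_, hle⟩
  have hdim := ringKrullDim_le_ringKrullDim_quotSMulTop_succ hx
  rw [← IsRegularLocalRing.spanFinrank_maximalIdeal, ← Submodule.ideal_span_singleton_smul,
    smul_eq_mul, mul_top] at hdim
  have h : (((maximalIdeal (A ⧸ span {x})).spanFinrank : WithBot ℕ∞) + 1) ≤
      ringKrullDim (A ⧸ span {x}) + 1 := le_trans (by exact_mod_cast hle) hdim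
  exact ENat.WithBot.add_le_add_one_right_iff.1 h

/-- A local ring that is a quotient of a regular local ring is a quotient of a regular local ring
by an ideal contained in the square of the maximal ideal: elements of the kernel outside the square
can be divided out one at a time, each lowering the embedding dimension. -/
lemma exists_surjective_ker_le {Q R : Type u} [CommRing Q] [IsRegularLocalRing Q] [CommRing R]
    [Nontrivial R] {f : Q →+* R} (hf : Function.Surjective f) :
    ∃ (P : Type u) (_ : CommRing P) (_ : IsRegularLocalRing P) (g : P →+* R),
      Function.Surjective g ∧ RingHom.ker g ≤ maximalIdeal P ^ 2 := by
  induction hn : (maximalIdeal Q).spanFinrank using Nat.strong_induction_on generalizing Q with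
  | _ n ih =>
    by_cases hker : RingHom.ker f ≤ maximalIdeal Q ^ 2
    · exact ⟨Q, inferInstance, inferInstance, f, hf, hker⟩
    obtain ⟨x, hx, hx'⟩ := SetLike.not_le_iff_exists.1 hker
    obtain ⟨_, hlt⟩ := quotient_span_singleton (le_maximalIdeal (RingHom.ker_ne_top f) hx) hx'
    refine ih _ (hn ▸ hlt) (Q := Q ⧸ span {x})
      (f := Ideal.Quotient.lift (span {x}) f fun a ha ↦ ?_) ?_ rfl
    · exact (span_singleton_le_iff_mem _).2 hx ha
    · exact Ideal.Quotient.lift_surjective_of_surjective _ _ hf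

end IsRegularLocalRing

/-! ### Adic completions of Noetherian local rings -/

namespace IsLocalRing

variable {A : Type*} [CommRing A] [IsLocalRing A] [IsNoetherianRing A]

/-- Ideals of a Noetherian local ring are closed (Krull's intersection theorem). -/
lemma mem_of_forall_mem_sup_pow {I : Ideal A} {x : A}
    (h : ∀ n, x ∈ I ⊔ maximalIdeal A ^ n) : x ∈ I := by
  rcases eq_or_ne I ⊤ with rfl | hI
  · trivial
  have : Nontrivial (A ⧸ I) := Ideal.Quotient.nontrivial_iff.2 hI
  have hsurj : Function.Surjective (Ideal.Quotient.mk I) := Ideal.Quotient.mk_surjective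
  have : IsLocalRing (A ⧸ I) := .of_surjective' _ hsurj
  rw [← Ideal.Quotient.eq_zero_iff_mem]
  refine IsHausdorff.haus (I := maximalIdeal (A ⧸ I)) inferInstance _ fun n ↦ ?_
  rw [SModEq.zero, smul_eq_mul, Ideal.mul_top, ← map_maximalIdeal_of_surjective _ hsurj,
    ← Ideal.map_pow]
  have hx := Ideal.mem_map_of_mem (Ideal.Quotient.mk I) (h n)
  rwa [Ideal.map_sup, Ideal.map_quotient_self, bot_sup_eq] at hx

/-- A complete Noetherian local ring is complete with respect to every proper ideal. -/
lemma isAdicComplete_of_le_maximalIdeal [IsAdicComplete (maximalIdeal A) A] {I : Ideal A}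
    (hI : I ≤ maximalIdeal A) : IsAdicComplete I A where
  toIsHausdorff := IsHausdorff.of_isLocalRing I A (ne_top_of_le_ne_top
    (maximalIdeal.isMaximal A).ne_top hI)
  prec' f hf := by
    obtain ⟨L, hL⟩ := IsPrecomplete.prec (I := maximalIdeal A) inferInstance (f := f)
      fun h ↦ (hf h).mono (Submodule.smul_mono_left (Ideal.pow_right_mono hI _))
    refine ⟨L, fun n ↦ ?_⟩
    rw [SModEq.sub_mem, smul_eq_mul, Ideal.mul_top]
    -- The limit `L` is within `I ^ n` of `f n`, because `I ^ n` is closed.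
    refine mem_of_forall_mem_sup_pow fun k ↦ ?_
    have h₁ := hf (le_max_left n k)
    have h₂ := hL (max n k)
    rw [SModEq.sub_mem, smul_eq_mul, Ideal.mul_top] at h₁ h₂
    rw [← sub_add_sub_cancel _ (f (max n k)) _]
    exact Submodule.add_mem_sup h₁ (Ideal.pow_le_pow_right (le_max_right n k) h₂)

end IsLocalRing

namespace AdicCompletion

variable {A B C : Type*} [CommRing A] [CommRing B] [CommRing C]

lemma evalₐ_algebraMap (I : Ideal A) (n : ℕ) (x : A) :
    evalₐ I n (algebraMap A (AdicCompletion I A) x) = Ideal.Quotient.mk (I ^ n) x :=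
  evalₐ_of I n x

lemma mem_map_pow_iff {I : Ideal A} (hI : I.FG) {n : ℕ} {x : AdicCompletion I A} :
    x ∈ (I.map (algebraMap A (AdicCompletion I A))) ^ n ↔ evalₐ I n x = 0 := by
  have hle : I ^ n • ⊤ ≤ I ^ n := by simp
  have hinj : Function.Injective (Ideal.Quotient.factor hle) := by
    simpa [RingHom.injective_iff_ker_eq_bot, Ideal.Quotient.factor_ker] using
      Ideal.map_mk_eq_bot_of_le (by simp)
  have hx : evalₐ I n x = 0 ↔ eval I A n x = 0 := by
    rw [← factor_eval_eq_evalₐ I x hle]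
    exact map_eq_zero_iff (Ideal.Quotient.factor hle) hinj
  rw [hx, ← Ideal.map_pow,
    ← Submodule.restrictScalars_mem A, ← Ideal.smul_top_eq_map, pow_smul_top_eq_ker_eval hI,
    LinearMap.mem_ker]

lemma factorPow_comp_quotientMap_comp_evalₐ {I : Ideal A} {J : Ideal B} (f : A →+* B)
    (h : ∀ n, I ^ n ≤ (J ^ n).comap f) {m n : ℕ} (hmn : m ≤ n) :
    (Ideal.Quotient.factorPow J hmn).comp ((Ideal.quotientMap (J ^ n) f (h n)).comp
      (evalₐ I n : AdicCompletion I A →+* A ⧸ I ^ n)) =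
    (Ideal.quotientMap (J ^ m) f (h m)).comp (evalₐ I m : AdicCompletion I A →+* A ⧸ I ^ m) := by
  ext x
  obtain ⟨a, rfl⟩ := mk_surjective I A x
  simp [evalₐ_mk, ← Ideal.mk_eq_mk I hmn]

lemma pow_le_comap_pow {I : Ideal A} {J : Ideal B} {f : A →+* B} (h : I ≤ J.comap f) (n : ℕ) :
    I ^ n ≤ (J ^ n).comap f :=
  (Ideal.pow_right_mono h n).trans (Ideal.le_comap_pow f n)

/-- The ring homomorphism between adic completions induced by a ring homomorphism. -/
noncomputable def mapRingHom {I : Ideal A} {J : Ideal B} (f : A →+* B) (h : I ≤ J.comap f) :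
    AdicCompletion I A →+* AdicCompletion J B :=
  liftRingHom J _ (factorPow_comp_quotientMap_comp_evalₐ f (pow_le_comap_pow h))

@[simp]
lemma evalₐ_mapRingHom {I : Ideal A} {J : Ideal B} (f : A →+* B) (h : I ≤ J.comap f) (n : ℕ)
    (x : AdicCompletion I A) : evalₐ J n (mapRingHom f h x) =
      Ideal.quotientMap (J ^ n) f (pow_le_comap_pow h n) (evalₐ I n x) :=
  evalₐ_liftRingHom J _ (factorPow_comp_quotientMap_comp_evalₐ f (pow_le_comap_pow h)) n x

lemma mapRingHom_algebraMap {I : Ideal A} {J : Ideal B} (f : A →+* B) (h : I ≤ J.comap f) (x : A) :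
    mapRingHom f h (algebraMap A _ x) = algebraMap B _ (f x) := by
  refine ext_evalₐ fun n ↦ ?_
  rw [evalₐ_mapRingHom, evalₐ_algebraMap, evalₐ_algebraMap, Ideal.quotientMap_mk]

lemma mapRingHom_mapRingHom {I : Ideal A} {J : Ideal B} {K : Ideal C} (f : A →+* B)
    (h : I ≤ J.comap f) (g : B →+* C) (h' : J ≤ K.comap g) (x : AdicCompletion I A) :
    mapRingHom g h' (mapRingHom f h x) = mapRingHom (g.comp f) (I := I) (J := K)
      (h.trans (Ideal.comap_mono h')) x := by
  refine ext_evalₐ fun n ↦ ?_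
  obtain ⟨a, ha⟩ := Ideal.Quotient.mk_surjective (evalₐ I n x)
  simp [← ha]

lemma mapRingHom_id {I : Ideal A} (h : I ≤ I.comap (RingHom.id A)) (x : AdicCompletion I A) :
    mapRingHom (RingHom.id A) h x = x := by
  refine ext_evalₐ fun n ↦ ?_
  obtain ⟨a, ha⟩ := Ideal.Quotient.mk_surjective (evalₐ I n x)
  rw [evalₐ_mapRingHom, ← ha, Ideal.quotientMap_mk, RingHom.id_apply]

/-- Isomorphic local rings have isomorphic completions. -/
noncomputable def congrRingEquiv [IsLocalRing A] [IsLocalRing B] (e : A ≃+* B) :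
    AdicCompletion (maximalIdeal A) A ≃+* AdicCompletion (maximalIdeal B) B :=
  RingEquiv.ofRingHom (mapRingHom e (maximalIdeal_comap (e : A →+* B)).ge)
    (mapRingHom e.symm (maximalIdeal_comap (e.symm : B →+* A)).ge)
    (by ext1 x; simpa [mapRingHom_mapRingHom] using mapRingHom_id _ x)
    (by ext1 x; simpa [mapRingHom_mapRingHom] using mapRingHom_id _ x)

lemma congrRingEquiv_algebraMap [IsLocalRing A] [IsLocalRing B] (e : A ≃+* B) (x : A) :
    congrRingEquiv e (algebraMap A _ x) = algebraMap B _ (e x) :=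
  mapRingHom_algebraMap (e : A →+* B) (maximalIdeal_comap (e : A →+* B)).ge x

lemma exists_sub_algebraMap_mem {I : Ideal A} (hI : I.FG) (n : ℕ) (x : AdicCompletion I A) :
    ∃ a : A, x - algebraMap A _ a ∈ (I.map (algebraMap A (AdicCompletion I A))) ^ n := by
  obtain ⟨a, ha⟩ := Ideal.Quotient.mk_surjective (evalₐ I n x)
  exact ⟨a, by rw [mem_map_pow_iff hI, map_sub, evalₐ_algebraMap, ha, sub_self]⟩

/-- If `B` is a quotient of the local ring `A` and `Â` is Noetherian, the kernel of `Â → B̂` is the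
extension of the kernel of `A → B`. -/
lemma ker_mapRingHom_of_surjective [IsLocalRing A] [IsNoetherianRing A] [IsLocalRing B]
    [IsNoetherianRing B] [IsNoetherianRing (AdicCompletion (maximalIdeal A) A)] {f : A →+* B}
    (hf : Function.Surjective f) (h : maximalIdeal A ≤ (maximalIdeal B).comap f) :
    RingHom.ker (mapRingHom f h) = (RingHom.ker f).map (algebraMap A _) := by
  refine le_antisymm (fun x hx ↦ mem_of_forall_mem_sup_pow fun n ↦ ?_) ?_
  · rw [maximalIdeal_eq_map]
    obtain ⟨a, ha⟩ := exists_sub_algebraMap_mem (maximalIdeal A).fg_of_isNoetherianRing n x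
    have hax : evalₐ _ n x = Ideal.Quotient.mk _ a := by
      rw [mem_map_pow_iff (maximalIdeal A).fg_of_isNoetherianRing, map_sub, evalₐ_algebraMap] at ha
      exact sub_eq_zero.1 ha
    have hfa : f a ∈ maximalIdeal B ^ n := by
      rw [← Ideal.Quotient.eq_zero_iff_mem, ← Ideal.quotientMap_mk (H := pow_le_comap_pow h n), ← hax, ← evalₐ_mapRingHom f h,
        RingHom.mem_ker.1 hx, _root_.map_zero]
    rw [← map_maximalIdeal_of_surjective f hf, ← Ideal.map_pow,
      Ideal.mem_map_iff_of_surjective f hf] at hfa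
    obtain ⟨b, hb, hba⟩ := hfa
    have hmem : algebraMap A (AdicCompletion (maximalIdeal A) A) (a - b) ∈
        (RingHom.ker f).map (algebraMap A (AdicCompletion (maximalIdeal A) A)) :=
      Ideal.mem_map_of_mem _ (by rw [RingHom.mem_ker, map_sub, hba, sub_self])
    rw [show x = algebraMap A _ (a - b) + (x - algebraMap A _ a + algebraMap A _ b) by
      rw [map_sub]; ring]
    refine Submodule.add_mem_sup hmem (add_mem ha ?_)
    rw [← Ideal.map_pow]
    exact Ideal.mem_map_of_mem _ hb
  · rw [Ideal.map_le_iff_le_comap]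
    intro a ha
    rw [Ideal.mem_comap, RingHom.mem_ker, mapRingHom_algebraMap, RingHom.mem_ker.1 ha, _root_.map_zero]

/-- Completion does not decrease the dimension: since it is faithfully flat, chains of primes lift by
going down. -/
lemma ringKrullDim_le [IsLocalRing A] [IsNoetherianRing A] :
    ringKrullDim A ≤ ringKrullDim (AdicCompletion (maximalIdeal A) A) := by
  refine iSup_le fun l ↦ ?_
  have : Module.FaithfullyFlat A (AdicCompletion (maximalIdeal A) A) := .of_flat_of_isLocalHom
  obtain ⟨P, hP⟩ := PrimeSpectrum.comap_surjective_of_faithfullyFlat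
    (B := AdicCompletion (maximalIdeal A) A) l.last
  have : P.asIdeal.LiesOver l.last.asIdeal := ⟨by rw [← hP]; rfl⟩
  obtain ⟨L, hL, -⟩ := Ideal.exists_ltSeries_of_hasGoingDown l P.asIdeal
  rw [← hL]
  exact Order.LTSeries.length_le_krullDim L

end AdicCompletion

/-! ### Lifting fields of characteristic zero -/

/-- A field of characteristic zero is formally smooth over `ℚ`, since it is a separable algebraic
extension of a purely transcendental one. -/
lemma Field.formallySmooth_rat (κ : Type*) [Field κ] [CharZero κ] [Algebra ℚ κ] :
    Algebra.FormallySmooth ℚ κ := by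
  obtain ⟨s, hs⟩ := exists_isTranscendenceBasis ℚ κ
  have := hs.isAlgebraic_field
  have : CharZero (IntermediateField.adjoin ℚ (Set.range ((↑) : s → κ))) := inferInstance
  have : Algebra.IsSeparable (IntermediateField.adjoin ℚ (Set.range ((↑) : s → κ))) κ :=
    inferInstance
  exact .of_algebraicIndependent_of_isSeparable hs.1

/-- A homomorphism from a field of characteristic zero to `A / I` lifts to `A`, if `A` contains
the rational numbers and is `I`-adically complete. -/
lemma exists_ringHom_mk_comp_eq {κ A : Type*} [Field κ] [CharZero κ] [CommRing A]
    (hA : ∀ n : ℕ, n ≠ 0 → IsUnit (n : A)) (I : Ideal A) [IsAdicComplete I A] (g : κ →+* A ⧸ I) :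
    ∃ s : κ →+* A, (Ideal.Quotient.mk I).comp s = g := by
  have hunit (y : nonZeroDivisors ℤ) : IsUnit (Int.castRingHom A y) := by
    have := hA (y : ℤ).natAbs (by simp)
    rcases Int.natAbs_eq (y : ℤ) with h | h <;> rw [h] <;> simpa
  let _ : Algebra ℚ A := (IsLocalization.lift (S := ℚ) hunit).toAlgebra
  have := Field.formallySmooth_rat κ
  obtain ⟨s, hs⟩ := Algebra.FormallySmooth.exists_mkₐ_comp_eq_of_isAdicComplete (I := I)
    g.toRatAlgHom
  exact ⟨s, RingHom.ext fun x ↦ DFunLike.congr_fun hs x⟩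

/-! ### Power series rings over a field -/

namespace MvPowerSeries

variable {σ κ A : Type*} [Finite σ]

section CommRing

variable [CommRing κ] [CommRing A]

/-- Every power series is a polynomial modulo a given power of the ideal of the variables. -/
lemma exists_sub_algebraMap_mem (n : ℕ) (p : MvPowerSeries σ κ) : ∃ q : MvPolynomial σ κ,
    p - algebraMap _ _ q ∈
      ((MvPolynomial.idealOfVars σ κ).map (algebraMap _ (MvPowerSeries σ κ))) ^ n := by
  let E := toAdicCompletionAlgEquiv σ κ
  obtain ⟨q, hq⟩ := AdicCompletion.exists_sub_algebraMap_mem (MvPolynomial.idealOfVars_fg σ κ) n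
    (E p)
  refine ⟨q, ?_⟩
  have h := Ideal.mem_map_of_mem E.symm.toAlgHom.toRingHom hq
  rw [Ideal.map_pow, Ideal.map_map] at h
  have hE : E.symm.toAlgHom.toRingHom.comp (algebraMap (MvPolynomial σ κ) _) =
      algebraMap _ _ := E.symm.toAlgHom.comp_algebraMap
  rw [hE, map_sub] at h
  have h₁ : E.symm.toAlgHom.toRingHom (E p) = p := E.symm_apply_apply p
  have h₂ : E.symm.toAlgHom.toRingHom (algebraMap _ _ q) = algebraMap _ _ q := E.symm.commutes q
  rwa [h₁, h₂] at h

/-- Evaluation of power series at elements of an ideal `I`, with values in an `I`-adically complete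
ring. -/
lemma exists_ringHom_algebraMap_eq {I : Ideal A} [IsAdicComplete I A] (s : κ →+* A) (a : σ → A)
    (ha : ∀ i, a i ∈ I) : ∃ F : MvPowerSeries σ κ →+* A,
      ∀ q : MvPolynomial σ κ, F (algebraMap _ _ q) = MvPolynomial.eval₂Hom s a q := by
  have hle : MvPolynomial.idealOfVars σ κ ≤ I.comap (MvPolynomial.eval₂Hom s a) := by
    rw [MvPolynomial.idealOfVars, Ideal.span_le]
    rintro _ ⟨i, rfl⟩
    simpa using ha i
  have hle' (n : ℕ) : MvPolynomial.idealOfVars σ κ ^ n ≤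
      (I ^ n).comap (MvPolynomial.eval₂Hom s a) :=
    (Ideal.pow_right_mono hle n).trans (Ideal.le_comap_pow _ n)
  let f (n : ℕ) : MvPowerSeries σ κ →+* A ⧸ I ^ n :=
    (Ideal.quotientMap (I ^ n) (MvPolynomial.eval₂Hom s a) (hle' n)).comp
      (truncTotalAlgHom σ κ n : MvPowerSeries σ κ →+* _)
  have hf {m n : ℕ} (hmn : m ≤ n) : (Ideal.Quotient.factorPow I hmn).comp (f n) = f m := by
    ext p
    have h := hle' m (truncTotal_sub_truncTotal_mem_pow_idealOfVars hmn le_rfl p)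
    rw [Ideal.mem_comap, map_sub, ← Ideal.Quotient.eq] at h
    simpa [f] using h
  refine ⟨IsAdicComplete.liftRingHom I f hf, fun q ↦ ?_⟩
  refine (IsHausdorff.eq_iff_smodEq (I := I)).2 fun n ↦ ?_
  rw [smul_eq_mul, Ideal.mul_top, SModEq.sub_mem, ← Ideal.Quotient.eq,
    IsAdicComplete.mk_liftRingHom]
  have h : truncTotalAlgHom σ κ n (algebraMap _ _ q) = Ideal.Quotient.mk _ q :=
    (truncTotalAlgHom σ κ n).commutes q
  change Ideal.quotientMap (I ^ n) (MvPolynomial.eval₂Hom s a) (hle' n)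
    (truncTotalAlgHom σ κ n (algebraMap _ _ q)) = _
  rw [h, Ideal.quotientMap_mk]

/-- Two homomorphisms from a power series ring that agree on polynomials are equal, if they send
the variables to an ideal with respect to which the target is separated. -/
lemma ringHom_ext_of_isHausdorff {I : Ideal A} [IsHausdorff I A] {F G : MvPowerSeries σ κ →+* A}
    (h : ∀ q : MvPolynomial σ κ, F (algebraMap _ _ q) = G (algebraMap _ _ q))
    (hF : ∀ i, F (X i) ∈ I) : F = G := by
  ext p
  refine (IsHausdorff.eq_iff_smodEq (I := I)).2 fun n ↦ ?_
  rw [smul_eq_mul, Ideal.mul_top, SModEq.sub_mem]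
  have hle (H : MvPowerSeries σ κ →+* A) (hH : ∀ i, H (X i) ∈ I) :
      (MvPolynomial.idealOfVars σ κ).map (algebraMap _ (MvPowerSeries σ κ)) ≤ I.comap H := by
    rw [MvPolynomial.idealOfVars, Ideal.map_span, Ideal.span_le]
    rintro _ ⟨_, ⟨i, rfl⟩, rfl⟩
    simpa [algebraMap_apply'] using hH i
  have hX (i : σ) : F (X i) = G (X i) := by simpa [algebraMap_apply'] using h (MvPolynomial.X i)
  obtain ⟨q, hq⟩ := exists_sub_algebraMap_mem n p
  rw [show F p - G p = F (p - algebraMap _ _ q) - G (p - algebraMap _ _ q) by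
    rw [map_sub, map_sub, h]; ring]
  exact sub_mem
    (Ideal.le_comap_pow F n (Ideal.pow_right_mono (hle F hF) n hq))
    (Ideal.le_comap_pow G n (Ideal.pow_right_mono (hle G fun i ↦ hX i ▸ hF i) n hq))

end CommRing

section Field

variable [Field κ] [CommRing A]

lemma maximalIdeal_eq : maximalIdeal (MvPowerSeries σ κ) = Ideal.span (Set.range X) := by
  have hspan : (MvPolynomial.idealOfVars σ κ).map (algebraMap _ (MvPowerSeries σ κ)) =
      Ideal.span (Set.range X) := by
    rw [MvPolynomial.idealOfVars, Ideal.map_span, ← Set.range_comp]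
    congr 2
    ext1 i
    simp [algebraMap_apply']
  have hX : Ideal.span (Set.range (X : σ → MvPowerSeries σ κ)) ≤
      RingHom.ker (constantCoeff (σ := σ) (R := κ)) := by
    rw [Ideal.span_le]
    rintro _ ⟨i, rfl⟩
    simp
  refine le_antisymm (fun p hp ↦ ?_) ?_
  · obtain ⟨q, hq⟩ := exists_sub_algebraMap_mem 1 p
    rw [pow_one, hspan] at hq
    have hp0 : constantCoeff p = 0 := by
      rw [mem_maximalIdeal, mem_nonunits_iff, isUnit_iff_constantCoeff, isUnit_iff_ne_zero] at hp
      simpa using hp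
    have hq0 : q ∈ MvPolynomial.idealOfVars σ κ := by
      have := hX hq
      rw [RingHom.mem_ker, map_sub, hp0, zero_sub, neg_eq_zero] at this
      rw [← pow_one (MvPolynomial.idealOfVars σ κ), MvPolynomial.mem_pow_idealOfVars_iff']
      intro x hx
      rw [(Finsupp.degree_eq_zero_iff x).1 (by lia), ← MvPolynomial.coeff_coe,
        coeff_zero_eq_constantCoeff_apply]
      simpa [algebraMap_apply'] using this
    rw [← sub_add_cancel p (algebraMap _ _ q)]
    exact add_mem hq (hspan ▸ Ideal.mem_map_of_mem _ hq0)
  · refine hX.trans (le_maximalIdeal (RingHom.ker_ne_top _))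

lemma ringKrullDim_fin_le (n : ℕ) : ringKrullDim (MvPowerSeries (Fin n) κ) ≤ n := by
  refine (ringKrullDim_le_spanFinrank_maximalIdeal _).trans ?_
  rw [maximalIdeal_eq]
  have h := Submodule.spanFinrank_span_le_ncard_of_finite (R := MvPowerSeries (Fin n) κ)
    (Set.finite_range (X : Fin n → MvPowerSeries (Fin n) κ))
  have h' : (Set.range (X : Fin n → MvPowerSeries (Fin n) κ)).ncard ≤ n := by
    rw [← Set.image_univ]
    exact (Set.ncard_image_le Set.finite_univ).trans (by simp [Set.ncard_univ])
  exact_mod_cast h.trans h'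

/-- A homomorphism from a power series ring in `n` variables to a complete local ring of dimension
at least `n` is an isomorphism if the variables generate the maximal ideal and the coefficients
exhaust the residue field. It is surjective by completeness; its kernel vanishes because a proper
quotient of the power series ring, which is a domain, has smaller dimension. -/
lemma bijective_of_span_eq_maximalIdeal [IsLocalRing A] [IsHausdorff (maximalIdeal A) A] {n : ℕ}
    (hdim : n ≤ ringKrullDim A) (F : MvPowerSeries (Fin n) κ →+* A)
    (hX : Ideal.span (Set.range fun i ↦ F (X i)) = maximalIdeal A)
    (hC : Function.Surjective ((residue A).comp (F.comp C))) : Function.Bijective F := by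
  have hmap : (Ideal.span (Set.range X)).map F = maximalIdeal A := by
    rw [Ideal.map_span, ← Set.range_comp]
    exact hX
  have : IsHausdorff ((Ideal.span (Set.range X)).map F) A := hmap ▸ inferInstance
  have hsurj : Function.Surjective F := by
    refine surjective_of_mk_map_comp_surjective (I := Ideal.span (Set.range X)) F ?_
    intro y
    obtain ⟨a, rfl⟩ := Ideal.Quotient.mk_surjective y
    obtain ⟨c, hc⟩ := hC (residue A a)
    refine ⟨C c, Ideal.Quotient.eq.2 ?_⟩
    rw [hmap]
    exact Ideal.Quotient.eq.1 hc
  refine ⟨(injective_iff_map_eq_zero F).2 fun p hp ↦ ?_, hsurj⟩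
  by_contra hp0
  have h₁ := ringKrullDim_succ_le_of_surjective F hsurj (mem_nonZeroDivisors_of_ne_zero hp0) hp
  have h₂ : ((n : WithBot ℕ∞) + 1) ≤ n :=
    (add_le_add_left hdim 1).trans (h₁.trans (ringKrullDim_fin_le n))
  have h₃ : n + 1 ≤ n := by exact_mod_cast h₂
  lia

end Field

end MvPowerSeries

/-! ### Comparison of presentations of the completion -/

lemma ContainsCharZeroField.isUnit_natCast {R : Type u} [CommRing R] (h : ContainsCharZeroField R)
    {n : ℕ} (hn : n ≠ 0) : IsUnit (n : R) := by
  obtain ⟨K, hK, _⟩ := h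
  obtain ⟨y, hy⟩ := hK.mul_inv_cancel (Nat.cast_ne_zero.2 hn : (n : K) ≠ 0)
  exact IsUnit.of_mul_eq_one (y : R) (by simpa using congrArg K.subtype hy)

namespace AdicCompletion

lemma map_maximalIdeal_mapRingHom {A B : Type*} [CommRing A] [CommRing B] [IsLocalRing A]
    [IsNoetherianRing A] [IsLocalRing B] [IsNoetherianRing B] {f : A →+* B}
    (hf : Function.Surjective f) (h : maximalIdeal A ≤ (maximalIdeal B).comap f) :
    (maximalIdeal (AdicCompletion (maximalIdeal A) A)).map (mapRingHom f h) =
      maximalIdeal (AdicCompletion (maximalIdeal B) B) := by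
  have hcomp : (mapRingHom f h).comp (algebraMap A _) = (algebraMap B _).comp f :=
    RingHom.ext (mapRingHom_algebraMap f h)
  rw [maximalIdeal_eq_map, Ideal.map_map, hcomp, ← Ideal.map_map,
    map_maximalIdeal_of_surjective f hf, ← maximalIdeal_eq_map]

/-- In residue characteristic zero, a presentation of `R̂` as a quotient of a complete regular local
ring `T` of dimension `edim R` is unique up to isomorphism: if `Q` is a regular local ring, `f` maps
`Q` onto `R` and `ker f ⊆ 𝔪 ^ 2`, then `Q̂ ≅ T` over `R̂`. Both rings are isomorphic to the same
power series ring over a coefficient field of `Q̂`, whose image in `R̂` is lifted to `T`. -/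
lemma exists_ringEquiv_of_surjective {Q R T : Type u} [CommRing Q] [IsRegularLocalRing Q]
    [CommRing R] [IsLocalRing R] [IsNoetherianRing R] [CommRing T] [IsLocalRing T]
    [IsNoetherianRing T] [IsAdicComplete (maximalIdeal T) T]
    (hdim : ringKrullDim T = (maximalIdeal R).spanFinrank)
    (hchar : ∀ n : ℕ, n ≠ 0 → IsUnit (n : R))
    {π : T →+* AdicCompletion (maximalIdeal R) R} (hπ : Function.Surjective π)
    (hker : RingHom.ker π ≤ maximalIdeal T ^ 2)
    {f : Q →+* R} (hf : Function.Surjective f) (hfker : RingHom.ker f ≤ maximalIdeal Q ^ 2)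
    (h : maximalIdeal Q ≤ (maximalIdeal R).comap f) :
    ∃ E : AdicCompletion (maximalIdeal Q) Q ≃+* T, ∀ x, π (E x) = mapRingHom f h x := by
  have hfloc := Function.Surjective.isLocalHom f hf
  have hπloc := Function.Surjective.isLocalHom π hπ
  set Q' := AdicCompletion (maximalIdeal Q) Q
  set R' := AdicCompletion (maximalIdeal R) R
  set f' : Q' →+* R' := mapRingHom f h
  have hf'max : (maximalIdeal Q').map f' = maximalIdeal R' := map_maximalIdeal_mapRingHom hf h
  have hQ (n : ℕ) (hn : n ≠ 0) : IsUnit (n : Q') := by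
    have : IsUnit (n : Q) := isUnit_of_map_unit f _ (by simpa using hchar n hn)
    simpa using this.map (algebraMap Q Q')
  have hT (n : ℕ) (hn : n ≠ 0) : IsUnit (n : T) :=
    isUnit_of_map_unit π _ (by simpa using (hchar n hn).map (algebraMap R R'))
  have : CharZero (ResidueField Q') := charZero_of_inj_zero fun n hn ↦ by
    by_contra hn0
    exact ((hQ n hn0).map (residue Q')).ne_zero (by rw [map_natCast, hn])
  -- The coefficient field of `Q'` and the lift to `T` of its image in `R'`.
  obtain ⟨s, hs'⟩ := exists_ringHom_mk_comp_eq hQ (maximalIdeal Q') (RingHom.id (ResidueField Q'))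
  have hs (c : ResidueField Q') : residue Q' (s c) = c := RingHom.congr_fun hs' c
  have : IsAdicComplete (RingHom.ker π) T :=
    isAdicComplete_of_le_maximalIdeal (le_maximalIdeal (RingHom.ker_ne_top π))
  let e := RingHom.quotientKerEquivOfSurjective hπ
  obtain ⟨t, ht'⟩ := exists_ringHom_mk_comp_eq hT (RingHom.ker π)
    ((e.symm : R' →+* _).comp (f'.comp s))
  have ht : π.comp t = f'.comp s := by
    refine RingHom.ext fun c ↦ ?_
    have := congrArg e (RingHom.congr_fun ht' c)
    simpa [e] using this
  -- Generators of the maximal ideals that correspond to each other.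
  obtain ⟨l, hl, hlen⟩ := Ideal.exists_ofList_eq_length_eq_spanFinrank (maximalIdeal Q)
  have hx : Ideal.span (Set.range l.get) = maximalIdeal Q := by
    rw [← hl, Ideal.ofList, Set.range_list_get]
  let a (i : Fin l.length) : Q' := algebraMap Q Q' (l.get i)
  have ha : Ideal.span (Set.range a) = maximalIdeal Q' := by
    refine .trans ?_ ((congrArg (Ideal.map (algebraMap Q Q')) hx).trans maximalIdeal_eq_map.symm)
    rw [Ideal.map_span, ← Set.range_comp]
    rfl
  choose y hy using fun i ↦ hπ (f' (a i))
  have hyspan : (Ideal.span (Set.range y)).map π = maximalIdeal R' := by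
    rw [← hf'max, ← ha, Ideal.map_span, Ideal.map_span, ← Set.range_comp, ← Set.range_comp]
    congr 2
    exact funext hy
  have hysup : Ideal.span (Set.range y) ⊔ RingHom.ker π = maximalIdeal T := by
    rw [← Ideal.comap_map_of_surjective' π hπ, hyspan, maximalIdeal_comap π]
  have hyT : Ideal.span (Set.range y) = maximalIdeal T := by
    refine le_antisymm (le_sup_left.trans hysup.le) ?_
    refine Submodule.le_of_le_smul_of_le_jacobson_bot (I := maximalIdeal T)
      (Ideal.fg_of_isNoetherianRing _) (maximalIdeal_le_jacobson _) (hysup.ge.trans ?_)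
    rw [smul_eq_mul, ← pow_two]
    exact sup_le_sup_left hker _
  obtain ⟨Φ, hΦ⟩ := MvPowerSeries.exists_ringHom_algebraMap_eq (I := maximalIdeal Q') s a
    fun i ↦ ha ▸ Ideal.subset_span ⟨i, rfl⟩
  obtain ⟨Ψ, hΨ⟩ := MvPowerSeries.exists_ringHom_algebraMap_eq (I := maximalIdeal T) t y
    fun i ↦ hyT ▸ Ideal.subset_span ⟨i, rfl⟩
  have hΦX (i) : Φ (MvPowerSeries.X i) = a i := by
    simpa [MvPowerSeries.algebraMap_apply'] using hΦ (MvPolynomial.X i)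
  have hΨX (i) : Ψ (MvPowerSeries.X i) = y i := by
    simpa [MvPowerSeries.algebraMap_apply'] using hΨ (MvPolynomial.X i)
  have hΦC (c) : Φ (MvPowerSeries.C c) = s c := by
    simpa [MvPowerSeries.algebraMap_apply'] using hΦ (MvPolynomial.C c)
  have hΨC (c) : Ψ (MvPowerSeries.C c) = t c := by
    simpa [MvPowerSeries.algebraMap_apply'] using hΨ (MvPolynomial.C c)
  have hΦbij : Function.Bijective Φ := by
    refine MvPowerSeries.bijective_of_span_eq_maximalIdeal ?_ Φ ?_ fun c ↦ ⟨c, ?_⟩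
    · rw [hlen, IsRegularLocalRing.spanFinrank_maximalIdeal]
      exact ringKrullDim_le
    · simpa only [hΦX] using ha
    · simp [hΦC, hs]
  have hΨbij : Function.Bijective Ψ := by
    refine MvPowerSeries.bijective_of_span_eq_maximalIdeal ?_ Ψ ?_ fun c ↦ ?_
    · rw [hlen, hdim]
      exact_mod_cast spanFinrank_maximalIdeal_le_of_ker_le hf hfker
    · simpa only [hΨX] using hyT
    · obtain ⟨z, rfl⟩ := residue_surjective c
      obtain ⟨r, hr⟩ := exists_sub_algebraMap_mem (maximalIdeal R).fg_of_isNoetherianRing 1 (π z)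
      obtain ⟨q, rfl⟩ := hf r
      rw [pow_one, ← maximalIdeal_eq_map] at hr
      refine ⟨residue Q' (algebraMap Q Q' q), ?_⟩
      have hq : s (residue Q' (algebraMap Q Q' q)) - algebraMap Q Q' q ∈ maximalIdeal Q' :=
        Ideal.Quotient.eq.1 (hs _)
      have hq' := hf'max ▸ Ideal.mem_map_of_mem f' hq
      rw [map_sub, mapRingHom_algebraMap] at hq'
      refine Ideal.Quotient.eq.2 ?_
      rw [← maximalIdeal_comap π, Ideal.mem_comap, map_sub, RingHom.comp_apply, hΨC,
        ← RingHom.comp_apply π t, ht]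
      simpa using sub_mem hq' hr
  have hcomp : π.comp Ψ = f'.comp Φ := by
    refine MvPowerSeries.ringHom_ext_of_isHausdorff (I := maximalIdeal R') (fun q ↦ ?_) fun i ↦ ?_
    · rw [RingHom.comp_apply, RingHom.comp_apply, hΦ, hΨ, MvPolynomial.coe_eval₂Hom,
        MvPolynomial.coe_eval₂Hom, MvPolynomial.hom_eval₂, MvPolynomial.hom_eval₂, ht]
      congr 1
      exact funext hy
    · rw [RingHom.comp_apply, hΨX, hy, ← hf'max]
      exact Ideal.mem_map_of_mem _ (ha ▸ Ideal.subset_span ⟨i, rfl⟩)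
  refine ⟨(RingEquiv.ofBijective Φ hΦbij).symm.trans (RingEquiv.ofBijective Ψ hΨbij), fun x ↦ ?_⟩
  obtain ⟨p, rfl⟩ := hΦbij.2 x
  have : (RingEquiv.ofBijective Φ hΦbij).symm (Φ p) = p :=
    (RingEquiv.ofBijective Φ hΦbij).symm_apply_apply p
  rw [RingEquiv.trans_apply, this]
  exact RingHom.congr_fun hcomp p

end AdicCompletion

/-- If `R` is a quotient of a Noetherian local ring `Q` and `Q̂ ≅ T` over `R̂`, then the image of `Q`
in `T` completes the diagram. -/
lemma exists_completesDiagram_of_ringEquiv {Q R T : Type u} [CommRing Q] [IsRegularLocalRing Q]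
    [CommRing R] [IsLocalRing R] [IsNoetherianRing R] [CommRing T] [IsLocalRing T]
    [IsNoetherianRing T] {π : T →+* AdicCompletion (maximalIdeal R) R} {f : Q →+* R}
    (hf : Function.Surjective f) (h : maximalIdeal Q ≤ (maximalIdeal R).comap f)
    (E : AdicCompletion (maximalIdeal Q) Q ≃+* T)
    (hE : ∀ x, π (E x) = AdicCompletion.mapRingHom f h x) :
    ∃ S : Subring T, CompletesDiagram π S := by
  have hinj : Function.Injective (algebraMap Q (AdicCompletion (maximalIdeal Q) Q)) :=
    AdicCompletion.of_injective _ _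
  let θ : Q →+* T := (E : _ →+* T).comp (algebraMap Q (AdicCompletion (maximalIdeal Q) Q))
  let e : Q ≃+* θ.range := RingEquiv.ofBijective θ.rangeRestrict
    ⟨fun a b hab ↦ hinj (E.injective (congrArg Subtype.val hab)), θ.rangeRestrict_surjective⟩
  have hS : IsRegularLocalRing θ.range := .of_ringEquiv e
  have hfloc := Function.Surjective.isLocalHom f hf
  have he (s : θ.range) : E (algebraMap Q _ (e.symm s)) = s :=
    congrArg Subtype.val (e.apply_symm_apply s)
  have : IsNoetherianRing (AdicCompletion (maximalIdeal Q) Q) :=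
    isNoetherianRing_of_ringEquiv T E.symm
  refine ⟨θ.range, hS, ⟨fun s hs ↦ ?_⟩, ⟨?_⟩, ⟨θ '' RingHom.ker f, ?_, ?_⟩,
    f.comp e.symm, ⟨fun s hs ↦ ?_⟩, hf.comp e.symm.surjective, fun s ↦ ?_⟩
  · rw [Subring.subtype_apply, ← he s] at hs
    have h₁ := isUnit_of_map_unit (algebraMap Q _) _ ((MulEquiv.isUnit_map E).1 hs)
    exact (MulEquiv.isUnit_map e.symm).1 h₁
  · refine AlgEquiv.ofRingEquiv (f := (AdicCompletion.congrRingEquiv e.symm).trans E) fun s ↦ ?_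
    rw [RingEquiv.trans_apply, AdicCompletion.congrRingEquiv_algebraMap, he]
    rfl
  · rintro _ ⟨a, -, rfl⟩
    exact ⟨a, rfl⟩
  · have hπE : RingHom.ker π = (RingHom.ker (AdicCompletion.mapRingHom f h)).map (E : _ →+* T) := by
      ext z
      have hEsurj : Function.Surjective (E : AdicCompletion (maximalIdeal Q) Q →+* T) :=
        E.surjective
      rw [Ideal.mem_map_iff_of_surjective _ hEsurj]
      refine ⟨fun hz ↦ ⟨E.symm z, ?_, E.apply_symm_apply z⟩, ?_⟩
      · rw [RingHom.mem_ker, ← hE, E.apply_symm_apply]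
        exact hz
      · rintro ⟨x, hx, rfl⟩
        exact (hE x).trans hx
    rw [hπE, AdicCompletion.ker_mapRingHom_of_surjective hf, Ideal.map_map, Ideal.map]
  · exact (MulEquiv.isUnit_map e.symm).1 (isUnit_of_map_unit f _ hs)
  · rw [← he s, hE, AdicCompletion.mapRingHom_algebraMap]
    rfl

theorem mainTheorem4 {R T : Type u} [CommRing R] [IsLocalRing R] [IsNoetherianRing R]
    [CommRing T] [IsRegularLocalRing T] [IsAdicComplete (maximalIdeal T) T]
    (hdim : ringKrullDim T = embeddingDimension R)
    (π : T →+* AdicCompletion (maximalIdeal R) R) (hπ : Function.Surjective π)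
    (hker : ∃ rs : List T, RingTheory.Sequence.IsRegular T rs ∧
      (∀ f ∈ rs, f ∈ maximalIdeal T ^ 2) ∧ Ideal.ofList rs = RingHom.ker π) :
    ((∃ S : Subring T, CompletesDiagram π S) → IsAbsoluteCompleteIntersection R) ∧
    (ContainsCharZeroField R → IsAbsoluteCompleteIntersection R →
      ∃ S : Subring T, CompletesDiagram π S) := by
  obtain ⟨rs, hrs, hrsm, hrsπ⟩ := hker
  refine ⟨fun ⟨S, hS⟩ ↦ hS.isAbsoluteCompleteIntersection ⟨rs, hrs, hrsπ⟩, ?_⟩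
  rintro hchar ⟨Q, _, _, qs, -, ⟨e⟩⟩
  obtain ⟨P, _, _, f, hf, hfker⟩ := IsRegularLocalRing.exists_surjective_ker_le
    (f := (e.symm : _ →+* R).comp (Ideal.Quotient.mk (Ideal.ofList qs)))
    (e.symm.surjective.comp Ideal.Quotient.mk_surjective)
  have hfloc := Function.Surjective.isLocalHom f hf
  rw [embeddingDimension, ← spanFinrank_maximalIdeal_eq_finrank_cotangentSpace] at hdim
  obtain ⟨E, hE⟩ := AdicCompletion.exists_ringEquiv_of_surjective hdim
    (fun n hn ↦ hchar.isUnit_natCast hn) hπ (hrsπ ▸ Ideal.span_le.2 hrsm) hf hfker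
    (maximalIdeal_comap f).ge
  exact exists_completesDiagram_of_ringEquiv hf _ E hE
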